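/- Let $Z=(Z(t))_{t\ge 0}$ be a Markov jump process on a probability space $(\Omega,\mathcal F,P)$ with values in the finite set $\{0,1,\ldots,n-1\}$ and with right-continuous paths having left limits. For $j\ne k$ let $N_{jk}(t)=\#\{s\in(0,t]: Z(s-)=j,\ Z(s)=k\}$. Assume that $Z$ has continuous transition intensities $\mu_{jk}:[0,\infty)\to\mathbb R$, $j\neq k$, i.e. each process $N_{jk}(t)-\int_0^t 1_{\{Z(u-)=j\}}\mu_{jk}(u)\,du$ is a martingale with respect to the filtration generated by $Z$. Put $\mu_{jj}=-\sum_{k\ne j}\mu_{jk}$ and let $\mu(t)$ be the $n\times n$ matrix $(\mu_{jk}(t))_{j,k}$. Let $\delta_0,\ldots,\delta_{n-1}:[0,\infty)\to\mathbb R$ be continuous deterministic functions and write $\operatorname{diag}(\delta)(t)$ for the diagonal matrix with entries $\delta_i(t)$. For $t\ge0$ and a state $i$, conditioning on $Z(t)=i$ is understood through a regular version of the conditional distribution of the path of $Z$ given $Z(t)=i$: if $P(Z(t)=i)>0$ this is the elementary conditional law, and if $P(Z(t)=i)=0$ it is any probability law on the space of paths under which the path is in state $i$ at time $t$ almost surely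 and is, from time $t$ on, a Markov jump process with the same transition intensities $\mu_{jk}$. For $0\le t\le s<\infty$ define the $\delta$-deflated transition probabilities $$p^\delta_{ij}(t,s)=\mathbb E\Big[1_{\{Z(s)=j\}}\,e^{-\int_t^s\delta_{Z(u)}(u)\,du}\,\Big|\,Z(t)=i\Big],\qquad p^\delta(t,s)=\big(p^\delta_{ij}(t,s)\big)_{i,j}.$$ Then, for all $0\le t\le s<\infty$, $p^\delta$ satisfies the forward ordinary differential equation system $$\frac{\partial}{\partial s}p^\delta(t,s)=p^\delta(t,s)\,\big[\mu-\operatorname{diag}(\delta)\big](s)$$ and the backward ordinary differential equation system $$\frac{\partial}{\partial t}p^\delta(t,s)=-\big[\mu-\operatorname{diag}(\delta)\big](t)\,p^\delta(t,s),$$ with boundary conditions $p^\delta(t,t)=I$, the $n\times n$ identity matrix. The derivatives exist, and at the end points of the domain $\{0\le t\le s\}$ they are one-sided (a derivative in $t$ at $t=s=0$ is not considered). -/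

import Mathlib

open Set Filter Topology MeasureTheory ProbabilityTheory

/-- The paths of a jump process with state space `{0, …, n - 1}`: functions on `[0, ∞)` (extended
to the negative axis by their value at `0`) that are right-continuous with left limits for the
discrete topology, so that they are piecewise constant with finitely many jumps on every compact
interval. -/
structure JumpPath (n : ℕ) where
  toFun : ℝ → Fin n
  eq_zero_of_nonpos : ∀ u, u ≤ 0 → toFun u = toFun 0
  right_continuous : ∀ u, ∀ᶠ v in 𝓝[>] u, toFun v = toFun u
  left_limit : ∀ u, ∃ k, ∀ᶠ v in 𝓝[<] u, toFun v = k

namespace JumpPath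

instance (n : ℕ) : CoeFun (JumpPath n) (fun _ => ℝ → Fin n) := ⟨JumpPath.toFun⟩

/-- The σ-algebra generated by the coordinate maps `z ↦ z u`. -/
instance (n : ℕ) : MeasurableSpace (JumpPath n) :=
  MeasurableSpace.comap JumpPath.toFun MeasurableSpace.pi

theorem measurable_eval {n : ℕ} (u : ℝ) : Measurable (fun z : JumpPath n => z u) :=
  (measurable_pi_apply u).comp (comap_measurable JumpPath.toFun)

end JumpPath

section MarkovJump

variable {n : ℕ} {Ω : Type*} [mΩ : MeasurableSpace Ω]

/-- The number of transitions from `j` to `k` in the time interval `(t, s]`. -/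
noncomputable def jumpCount (z : JumpPath n) (j k : Fin n) (t s : ℝ) : ℕ :=
  Set.ncard {u ∈ Ioc t s | Function.leftLim z u = j ∧ z u = k}

/-- The filtration indexed by `[t₀, ∞)` that the process `(Z u)` generates from time `t₀` on. -/
def historyFrom (t₀ : ℝ) (Z : Ω → JumpPath n) (hZ : Measurable Z) :
    Filtration (Ici t₀) mΩ where
  seq s := ⨆ u ∈ Icc t₀ (s : ℝ), MeasurableSpace.comap (fun ω => Z ω u) ⊤
  mono' _ _ hst := biSup_mono fun _ hu => ⟨hu.1, hu.2.trans hst⟩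
  le' _ := iSup₂_le fun u _ => ((JumpPath.measurable_eval u).comp hZ).comap_le

/-- The intensity process `1{Z(u-) = j} μ_{jk}(u)` along the path `z`. -/
noncomputable def intensityProcess (μ : Fin n → Fin n → ℝ → ℝ) (z : JumpPath n) (j k : Fin n)
    (u : ℝ) : ℝ :=
  if Function.leftLim z u = j then μ j k u else 0

/-- On the time interval `[t₀, ∞)` and under `P`, the process `Z` is a Markov jump process with
transition intensities `μ j k`, `j ≠ k`: it has the Markov property, and each of its counting
processes `N_{jk}` has intensity process `1{Z(u-) = j} μ_{jk}(u)`, i.e. the compensated counting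
process is a martingale. -/
structure IsMarkovJumpProcess (μ : Fin n → Fin n → ℝ → ℝ) (t₀ : ℝ) (P : Measure Ω)
    (Z : Ω → JumpPath n) (hZ : Measurable Z) : Prop where
  markov : ∀ t s : Ici t₀, t ≤ s → ∀ j : Fin n,
    P[{ω | Z ω s = j}.indicator (fun _ => (1 : ℝ)) | historyFrom t₀ Z hZ t]
      =ᵐ[P] P[{ω | Z ω s = j}.indicator (fun _ => (1 : ℝ)) |
        MeasurableSpace.comap (fun ω => Z ω t) ⊤]
  intensity : ∀ j k : Fin n, j ≠ k →
    Martingale (fun (s : Ici t₀) ω => (jumpCount (Z ω) j k t₀ s : ℝ)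
        - ∫ u in t₀..(s : ℝ), intensityProcess μ (Z ω) j k u)
      (historyFrom t₀ Z hZ) P

/-- `κ t i` is a regular version of the conditional distribution of the path of `Z` given
`Z(t) = i`. If `P(Z(t) = i) > 0` this is the elementary conditional law. If `P(Z(t) = i) = 0`, the
version is taken such that under `κ t i` the path is in state `i` at time `t` and evolves from there
as a Markov jump process with the transition intensities `μ`. -/
structure IsRegularConditionalLaw (μ : Fin n → Fin n → ℝ → ℝ) (P : Measure Ω)
    (Z : Ω → JumpPath n) (κ : ℝ → Fin n → Measure (JumpPath n)) : Prop where
  of_pos : ∀ t, 0 ≤ t → ∀ i, P {ω | Z ω t = i} ≠ 0 →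
    κ t i = (P[|{ω | Z ω t = i}]).map Z
  of_null : ∀ t, 0 ≤ t → ∀ i, P {ω | Z ω t = i} = 0 →
    IsProbabilityMeasure (κ t i) ∧ (∀ᵐ z ∂(κ t i), z t = i) ∧
      IsMarkovJumpProcess μ t (κ t i) id measurable_id

/-- The matrix of transition intensities, with `μ_{jj} = -∑_{k ≠ j} μ_{jk}` on the diagonal. -/
def intensityMatrix (μ : Fin n → Fin n → ℝ → ℝ) (t : ℝ) : Matrix (Fin n) (Fin n) ℝ :=
  Matrix.of fun j k => if j = k then -∑ l ∈ Finset.univ.erase j, μ j l t else μ j k t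

/-- The `δ`-deflated transition probabilities
`p^δ_{ij}(t, s) = E[1{Z(s) = j} exp(-∫_t^s δ_{Z(u)}(u) du) | Z(t) = i]`, computed under the
regular version `κ` of the conditional distributions. -/
noncomputable def deflatedTransition (κ : ℝ → Fin n → Measure (JumpPath n))
    (δ : Fin n → ℝ → ℝ) (t s : ℝ) : Matrix (Fin n) (Fin n) ℝ :=
  Matrix.of fun i j => ∫ z, {z : JumpPath n | z s = j}.indicator
    (fun z => Real.exp (-∫ u in t..s, δ (z u) u)) z ∂(κ t i)

end MarkovJump

/-!
Fix `t` and `i`, and let `Q` be the conditional law of the path given `Z(t) = i`.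

*Dynkin's formula.* Along a path, the indicator of the state `j` increases by the number of
transitions into `j` minus the number of transitions out of `j`
(`JumpPath.ite_sub_ite_eq_sum_jumpCount`). The compensated counting processes are martingales, so
the increment of the indicator over `[s, s']` has, given the past, the same expectation as the
integral of the entry of the intensity matrix at `(z(u), j)`
(`IsMarkovJumpProcess.integral_mul_increment`). This passes to `Q`, whether `Q` is an elementary
conditional law or a version at a state of probability zero
(`IsRegularConditionalLaw.hasDynkinFormula`).

*Forward equation.* Multiplying the indicator by the discount factor up to time `s`, which is
bounded and known at time `s`, expresses an increment of the deflated probability as the expectation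
of `deflatedIncrement`. No stochastic integral is needed: this integrand is at most a constant times
`s' - s`, so the deflated probability is continuous, and dominated convergence along the
right-continuous paths gives its right derivative, which is the right-hand side of the forward
equation. A continuous function with a continuous right derivative is differentiable
(`hasDerivWithinAt_Ici_of_right`).

*Backward equation.* It is a consequence of the forward equation, for matrices as in every normed
`ℝ`-algebra. Uniqueness for the forward equation gives `p(t, r) p(r, s) = p(t, s)`
(`mul_eq_of_forward`), and the expansion `p(a, b) = 1 + (b - a) B(t) + o(b - a)` for `a`, `b` close
to `t` turns this into the derivative in the first variable (`hasDerivWithinAt_backward`).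
-/

/-! ### Jumps of a path -/

/-- A function that is locally constant from the right and from the left is constant. -/
theorem eq_of_eventuallyEq_nhdsGT_nhdsLT {F : ℝ → ℝ} {a b : ℝ} (hab : a ≤ b)
    (hr : ∀ x ∈ Ico a b, ∀ᶠ v in 𝓝[>] x, F v = F x)
    (hl : ∀ x ∈ Ioc a b, ∀ᶠ v in 𝓝[<] x, F v = F x) : F b = F a := by
  have hright : ∀ x ∈ Ico a b, HasDerivWithinAt F 0 (Ici x) x := fun x hx => by
    rw [← hasDerivWithinAt_Ioi_iff_Ici]
    exact (hasDerivWithinAt_const x _ (F x)).congr_of_eventuallyEq (hr x hx) rfl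
  refine constant_of_has_deriv_right_zero (fun x hx => ?_) hright b (right_mem_Icc.2 hab)
  rw [← Icc_union_Icc_eq_Icc hx.1 hx.2]
  refine ContinuousWithinAt.union ?_ ?_
  · rcases hx.1.eq_or_lt with rfl | h
    · simp
    · refine ContinuousWithinAt.mono ?_ (Icc_subset_Iic_self (a := a))
      rw [← continuousWithinAt_Iio_iff_Iic]
      exact tendsto_const_nhds.congr' ((hl x ⟨h, hx.2⟩).mono fun v hv => hv.symm)
  · rcases hx.2.eq_or_lt with rfl | h
    · simp
    · exact (hright x ⟨hx.1, h⟩).continuousWithinAt.mono Icc_subset_Ici_self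

namespace JumpPath

variable {n : ℕ}

theorem eventually_nhdsLT_eq_leftLim (z : JumpPath n) (u : ℝ) :
    ∀ᶠ v in 𝓝[<] u, z v = Function.leftLim z u := by
  obtain ⟨k, hk⟩ := z.left_limit u
  have h : Tendsto z (𝓝[<] u) (𝓝 k) :=
    tendsto_const_nhds.congr' (hk.mono fun v hv => hv.symm)
  rwa [leftLim_eq_of_tendsto h]

theorem leftLim_eq_of_eventually {z : JumpPath n} {u : ℝ} {k : Fin n}
    (h : ∀ᶠ v in 𝓝[<] u, z v = k) : Function.leftLim z u = k := by
  obtain ⟨v, hv, hv'⟩ := (h.and (z.eventually_nhdsLT_eq_leftLim u)).exists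
  exact hv'.symm.trans hv

theorem exists_forall_Ioo_right (z : JumpPath n) (u : ℝ) :
    ∃ b > u, ∀ v ∈ Ioo u b, Function.leftLim z v = z u ∧ z v = z u := by
  obtain ⟨b, hb, hs⟩ := mem_nhdsGT_iff_exists_Ioo_subset.1 (z.right_continuous u)
  refine ⟨b, hb, fun v hv => ⟨leftLim_eq_of_eventually ?_, hs hv⟩⟩
  filter_upwards [Ioo_mem_nhdsLT hv.1] with w hw
  exact hs ⟨hw.1, hw.2.trans hv.2⟩

theorem exists_forall_Ioo_left (z : JumpPath n) (u : ℝ) :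
    ∃ a < u, ∀ v ∈ Ioo a u,
      Function.leftLim z v = Function.leftLim z u ∧ z v = Function.leftLim z u := by
  obtain ⟨a, ha, hs⟩ := mem_nhdsLT_iff_exists_Ioo_subset.1 (z.eventually_nhdsLT_eq_leftLim u)
  refine ⟨a, ha, fun v hv => ⟨leftLim_eq_of_eventually ?_, hs hv⟩⟩
  filter_upwards [Ioo_mem_nhdsLT hv.1] with w hw
  exact hs ⟨hw.1, hw.2.trans hv.2⟩

/-- A path has finitely many jumps on a compact interval: every point has a neighbourhood that
contains no jump, except possibly at the point itself. -/
theorem finite_jumps_inter_Icc (z : JumpPath n) (a b : ℝ) :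
    ({u | Function.leftLim z u ≠ z u} ∩ Icc a b).Finite := by
  refine isCompact_Icc.induction_on (p := fun s => ({u | Function.leftLim z u ≠ z u} ∩ s).Finite)
    (by simp) (fun s t hst ht => ht.subset (inter_subset_inter_right _ hst))
    (fun s t hs ht => by rw [inter_union_distrib_left]; exact hs.union ht) fun u _ => ?_
  obtain ⟨d, hd, hd'⟩ := z.exists_forall_Ioo_right u
  obtain ⟨c, hc, hc'⟩ := z.exists_forall_Ioo_left u
  refine ⟨Ioo c d, mem_nhdsWithin_of_mem_nhds (Ioo_mem_nhds hc hd), (finite_singleton u).subset ?_⟩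
  rintro v ⟨hv, hvc, hvd⟩
  rcases lt_trichotomy v u with h | h | h
  · exact absurd ((hc' v ⟨hvc, h⟩).1.trans (hc' v ⟨hvc, h⟩).2.symm) hv
  · exact h
  · exact absurd ((hd' v ⟨h, hvd⟩).1.trans (hd' v ⟨h, hvd⟩).2.symm) hv

theorem ae_leftLim_eq (z : JumpPath n) : ∀ᵐ u : ℝ, Function.leftLim z u = z u := by
  have hc : {u | Function.leftLim z u ≠ z u}.Countable := by
    refine (countable_iUnion fun m : ℕ =>
      (z.finite_jumps_inter_Icc (-(m : ℝ)) m).countable).mono fun u hu => ?_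
    obtain ⟨m, hm⟩ := exists_nat_ge |u|
    exact mem_iUnion.2 ⟨m, hu, abs_le.1 hm⟩
  filter_upwards [hc.ae_notMem volume] with u hu
  simpa using hu

theorem finite_transitions (z : JumpPath n) {j k : Fin n} (hjk : j ≠ k) (a b : ℝ) :
    {u ∈ Ioc a b | Function.leftLim z u = j ∧ z u = k}.Finite :=
  (z.finite_jumps_inter_Icc a b).subset fun u hu =>
    ⟨by simp only [mem_ofPred_eq, hu.2.1, hu.2.2]; exact hjk, Ioc_subset_Icc_self hu.1⟩

theorem jumpCount_add (z : JumpPath n) {j k : Fin n} (hjk : j ≠ k) {a b c : ℝ} (hab : a ≤ b)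
    (hbc : b ≤ c) : jumpCount z j k a c = jumpCount z j k a b + jumpCount z j k b c := by
  unfold jumpCount
  rw [← Set.ncard_union_eq ?_ (z.finite_transitions hjk _ _) (z.finite_transitions hjk _ _)]
  · congr 1
    rw [← Ioc_union_Ioc_eq_Ioc hab hbc]
    ext u
    simp only [mem_ofPred_eq, mem_union]
    tauto
  · exact Set.disjoint_left.2 fun u hu hu' => hu.1.2.not_gt hu'.1.1

theorem eventually_jumpCount_nhdsGT (z : JumpPath n) {j k : Fin n} (hjk : j ≠ k) (s : ℝ) :
    ∀ᶠ v in 𝓝[>] s, jumpCount z j k s v = 0 := by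
  obtain ⟨b, hb, h⟩ := z.exists_forall_Ioo_right s
  filter_upwards [Ioo_mem_nhdsGT hb] with v hv
  have : {u ∈ Ioc s v | Function.leftLim z u = j ∧ z u = k} = ∅ := by
    refine eq_empty_of_forall_notMem fun u hu => hjk ?_
    have := h u ⟨hu.1.1, hu.1.2.trans_lt hv.2⟩
    rw [← hu.2.1, ← hu.2.2, this.1, this.2]
  rw [jumpCount, this, ncard_empty]

theorem eventually_jumpCount_nhdsLT (z : JumpPath n) {j k : Fin n} (hjk : j ≠ k) (s : ℝ) :
    ∀ᶠ v in 𝓝[<] s,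
      jumpCount z j k v s = if Function.leftLim z s = j ∧ z s = k then 1 else 0 := by
  obtain ⟨a, ha, h⟩ := z.exists_forall_Ioo_left s
  filter_upwards [Ioo_mem_nhdsLT ha] with v hv
  have key : ∀ u ∈ Ioc v s, Function.leftLim z u = j ∧ z u = k → u = s := fun u hu hu' => by
    refine hu.2.eq_or_lt.resolve_right fun hlt => hjk ?_
    have := h u ⟨hv.1.trans hu.1, hlt⟩
    rw [← hu'.1, ← hu'.2, this.1, this.2]
  unfold jumpCount
  split_ifs with hs
  · rw [ncard_eq_one]
    refine ⟨s, Subset.antisymm (fun u hu => key u hu.1 hu.2) ?_⟩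
    rintro u rfl
    exact ⟨⟨hv.2, le_rfl⟩, hs⟩
  · have : {u ∈ Ioc v s | Function.leftLim z u = j ∧ z u = k} = ∅ := by
      refine eq_empty_of_forall_notMem fun u hu => hs ?_
      rw [← key u hu.1 hu.2]
      exact hu.2
    rw [this, ncard_empty]

/-- The change of the indicator of the state `j` is the number of transitions into `j` minus the
number of transitions out of `j`: the difference of the two sides is a locally constant function
of `s`. -/
theorem ite_sub_ite_eq_sum_jumpCount (z : JumpPath n) (j : Fin n) {t s : ℝ} (hts : t ≤ s) :
    (if z s = j then (1 : ℝ) else 0) - (if z t = j then 1 else 0)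
      = ∑ k ∈ Finset.univ.erase j, ((jumpCount z k j t s : ℝ) - jumpCount z j k t s) := by
  have h := eq_of_eventuallyEq_nhdsGT_nhdsLT (a := t) (b := s)
    (F := fun x => (if z x = j then (1 : ℝ) else 0)
      - ∑ k ∈ Finset.univ.erase j, ((jumpCount z k j t x : ℝ) - jumpCount z j k t x)) hts ?_ ?_
  · have h0 : ∀ k l, jumpCount z k l t t = 0 := fun k l => by simp [jumpCount]
    simp only [h0, Nat.cast_zero, sub_self, Finset.sum_const_zero, sub_zero] at h
    linarith
  · intro x hx
    have hc : ∀ᶠ v in 𝓝[>] x, ∀ k, k ≠ j → jumpCount z k j x v = 0 ∧ jumpCount z j k x v = 0 := by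
      rw [eventually_all]
      intro k
      by_cases hk : k = j
      · simp [hk]
      · filter_upwards [z.eventually_jumpCount_nhdsGT hk x,
          z.eventually_jumpCount_nhdsGT (Ne.symm hk) x] with v h1 h2 _ using ⟨h1, h2⟩
    filter_upwards [hc, z.right_continuous x, self_mem_nhdsWithin] with v hv hz hxv
    rw [hz]
    congr 1
    refine Finset.sum_congr rfl fun k hk => ?_
    have hk := Finset.ne_of_mem_erase hk
    rw [z.jumpCount_add hk hx.1 (le_of_lt hxv), z.jumpCount_add hk.symm hx.1 (le_of_lt hxv),
      (hv k hk).1, (hv k hk).2, add_zero, add_zero]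
  · intro x hx
    have hc : ∀ᶠ v in 𝓝[<] x, ∀ k, k ≠ j →
        jumpCount z k j v x = (if Function.leftLim z x = k ∧ z x = j then 1 else 0) ∧
        jumpCount z j k v x = (if Function.leftLim z x = j ∧ z x = k then 1 else 0) := by
      rw [eventually_all]
      intro k
      by_cases hk : k = j
      · simp [hk]
      · filter_upwards [z.eventually_jumpCount_nhdsLT hk x,
          z.eventually_jumpCount_nhdsLT (Ne.symm hk) x] with v h1 h2 _ using ⟨h1, h2⟩
    filter_upwards [hc, z.eventually_nhdsLT_eq_leftLim x, Ioo_mem_nhdsLT hx.1] with v hv hz hxv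
    have hsum : ∑ k ∈ Finset.univ.erase j, ((jumpCount z k j t x : ℝ) - jumpCount z j k t x)
        = ∑ k ∈ Finset.univ.erase j, ((jumpCount z k j t v : ℝ) - jumpCount z j k t v)
          + ∑ k ∈ Finset.univ.erase j, ((if z v = k ∧ z x = j then (1 : ℝ) else 0)
            - if z v = j ∧ z x = k then 1 else 0) := by
      rw [← Finset.sum_add_distrib]
      refine Finset.sum_congr rfl fun k hk => ?_
      have hk := Finset.ne_of_mem_erase hk
      rw [z.jumpCount_add hk hxv.1.le hxv.2.le, z.jumpCount_add hk.symm hxv.1.le hxv.2.le,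
        (hv k hk).1, (hv k hk).2, hz]
      push_cast
      ring
    have hstep : ∑ k ∈ Finset.univ.erase j, ((if z v = k ∧ z x = j then (1 : ℝ) else 0)
        - if z v = j ∧ z x = k then 1 else 0)
          = (if z x = j then 1 else 0) - if z v = j then 1 else 0 := by
      rw [Finset.sum_sub_distrib]
      by_cases h1 : z x = j <;> by_cases h2 : z v = j <;> simp [h1, h2, Finset.sum_ite_eq]
    simp only [hsum, hstep]
    ring

end JumpPath

/-! ### Measurability of integrals along a path -/

/-- A right-continuous process with values in a finite discrete space is jointly measurable: it is
the limit of the processes that read the state at the next point of the grid `(k + 1)⁻¹ ℤ`. -/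
theorem measurable_uncurry_of_rightContinuous {n : ℕ} {Ω : Type*} [MeasurableSpace Ω]
    {Y : ℝ → Ω → Fin n} (hY : ∀ u, Measurable (Y u))
    (hr : ∀ ω u, ∀ᶠ v in 𝓝[>] u, Y v ω = Y u ω) :
    Measurable fun q : ℝ × Ω => Y q.1 q.2 := by
  have hm : ∀ k : ℕ, Measurable fun q : ℝ × Ω =>
      Y (((⌊q.1 * (k + 1)⌋ : ℝ) + 1) / (k + 1)) q.2 := fun k => by
    have h1 : Measurable fun r : ℤ × Ω => Y (((r.1 : ℝ) + 1) / (k + 1)) r.2 :=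
      measurable_from_prod_countable_right fun i => hY (((i : ℝ) + 1) / (k + 1))
    have h2 : Measurable fun q : ℝ × Ω => ((⌊q.1 * (k + 1)⌋ : ℤ), q.2) :=
      (Int.measurable_floor.comp (measurable_fst.mul_const _)).prodMk measurable_snd
    exact h1.comp h2
  refine measurable_of_tendsto_metrizable hm (tendsto_pi_nhds.2 fun q => ?_)
  have hgrid : Tendsto (fun k : ℕ => ((⌊q.1 * (k + 1)⌋ : ℝ) + 1) / (k + 1)) atTop (𝓝[>] q.1) := by
    have hgt : ∀ k : ℕ, q.1 < ((⌊q.1 * (k + 1)⌋ : ℝ) + 1) / (k + 1) := fun k => by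
      rw [lt_div_iff₀ (by positivity)]
      exact Int.lt_floor_add_one _
    refine tendsto_nhdsWithin_iff.2 ⟨?_, Eventually.of_forall hgt⟩
    have hlim : Tendsto (fun k : ℕ => q.1 + 1 / ((k : ℝ) + 1)) atTop (𝓝 q.1) := by
      simpa using tendsto_const_nhds.add (tendsto_one_div_add_atTop_nhds_zero_nat (𝕜 := ℝ))
    refine tendsto_of_tendsto_of_tendsto_of_le_of_le tendsto_const_nhds hlim
      (fun k => (hgt k).le) fun k => ?_
    simp only []
    rw [div_le_iff₀ (by positivity), add_mul, one_div, inv_mul_cancel₀ (by positivity)]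
    linarith [Int.floor_le (q.1 * ((k : ℝ) + 1))]
  exact tendsto_const_nhds.congr' ((hgrid.eventually (hr q.2 q.1)).mono fun k hk => hk.symm)

namespace JumpPath

variable {n : ℕ}

theorem measurable_coe (z : JumpPath n) : Measurable (z : ℝ → Fin n) :=
  (measurable_uncurry_of_rightContinuous (Y := fun u (_ : Unit) => z u)
    (fun _ => measurable_const) fun _ u => z.right_continuous u).comp
    (measurable_id.prodMk (measurable_const (a := ())))

theorem measurable_comp (z : JumpPath n) {g : Fin n → ℝ → ℝ} (hg : ∀ k, Measurable (g k)) :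
    Measurable fun u => g (z u) u :=
  (measurable_from_prod_countable_right (f := fun q : Fin n × ℝ => g q.1 q.2) hg).comp
    (z.measurable_coe.prodMk measurable_id)

theorem intervalIntegrable_comp (z : JumpPath n) {g : Fin n → ℝ → ℝ} (hg : ∀ k, Measurable (g k))
    {a b C : ℝ} (hC : ∀ k, ∀ u ∈ uIcc a b, |g k u| ≤ C) :
    IntervalIntegrable (fun u => g (z u) u) volume a b := by
  refine (intervalIntegrable_const (c := C)).mono_fun (z.measurable_comp hg).aestronglyMeasurable ?_
  filter_upwards [ae_restrict_mem measurableSet_uIoc] with u hu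
  exact (hC _ u (uIoc_subset_uIcc hu)).trans (le_abs_self C)

/-- Integrals along a path over `[a, b]` are measurable for every σ-algebra for which the states in
the time interval `[a, b]` are measurable. -/
theorem measurable_intervalIntegral_comp {Ω : Type*} [MeasurableSpace Ω] {W : Ω → JumpPath n}
    {a b : ℝ} (hab : a ≤ b) (hW : ∀ u ∈ Icc a b, Measurable fun ω => W ω u) {g : Fin n → ℝ → ℝ}
    (hg : ∀ k, Measurable (g k)) : Measurable fun ω => ∫ u in a..b, g (W ω u) u := by
  -- freezing the path outside `[a, b]` gives a process that is measurable at all times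
  have hmem : ∀ u, max a (min u b) ∈ Icc a b := fun u =>
    ⟨le_max_left _ _, max_le hab (min_le_right _ _)⟩
  have hY : Measurable fun q : ℝ × Ω => W q.2 (max a (min q.1 b)) := by
    refine measurable_uncurry_of_rightContinuous (Y := fun u ω => W ω (max a (min u b)))
      (fun u => hW _ (hmem u)) fun ω u => ?_
    have hc : Tendsto (fun v : ℝ => max a (min v b)) (𝓝[>] u) (𝓝[≥] (max a (min u b))) := by
      refine tendsto_nhdsWithin_iff.2 ⟨?_, ?_⟩
      · have : Continuous fun v : ℝ => max a (min v b) := by fun_prop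
        exact this.continuousWithinAt
      · filter_upwards [self_mem_nhdsWithin] with v hv
        exact max_le_max_left _ (min_le_min_right _ (mem_Ioi.1 hv).le)
    have hr : ∀ᶠ x in 𝓝[≥] (max a (min u b)), W ω x = W ω (max a (min u b)) := by
      rw [← Ioi_insert, nhdsWithin_insert, eventually_sup]
      exact ⟨by simp, (W ω).right_continuous _⟩
    exact hc.eventually hr
  have hjoint : Measurable
      (Function.uncurry fun (u : ℝ) (ω : Ω) => g (W ω (max a (min u b))) u) :=
    (measurable_from_prod_countable_right (f := fun q : Fin n × ℝ => g q.1 q.2) hg).comp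
      (hY.prodMk measurable_fst)
  have := (hjoint.stronglyMeasurable.integral_prod_left (μ := volume.restrict (Ioc a b))).measurable
  convert this using 2 with ω
  rw [intervalIntegral.integral_of_le hab]
  refine setIntegral_congr_fun measurableSet_Ioc fun u hu => ?_
  simp only [min_eq_left hu.2, max_eq_right hu.1.le]

end JumpPath

/-! ### The martingale property of the counting processes -/

theorem historyFrom_measurable_eval {n : ℕ} {Ω : Type*} [MeasurableSpace Ω] {t₀ : ℝ}
    {Z : Ω → JumpPath n} (hZ : Measurable Z) (s : Ici t₀) {u : ℝ} (hu : u ∈ Icc t₀ (s : ℝ)) :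
    Measurable[historyFrom t₀ Z hZ s] fun ω => Z ω u :=
  Measurable.mono (comap_measurable _)
    (le_iSup₂_of_le (f := fun u (_ : u ∈ Icc t₀ (s : ℝ)) =>
      MeasurableSpace.comap (fun ω => Z ω u) ⊤) u hu le_rfl) le_rfl

theorem MeasureTheory.Martingale.integral_mul_eq {Ω ι : Type*} {m0 : MeasurableSpace Ω}
    [Preorder ι] {ℱ : Filtration ι m0} {P : Measure Ω} [IsFiniteMeasure P] {M : ι → Ω → ℝ}
    (hM : Martingale M ℱ P) {s s' : ι} (hs : s ≤ s') {H : Ω → ℝ} (hH : StronglyMeasurable[ℱ s] H)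
    {C : ℝ} (hC : ∀ ω, |H ω| ≤ C) : ∫ ω, H ω * M s' ω ∂P = ∫ ω, H ω * M s ω ∂P := by
  have h1 := condExp_stronglyMeasurable_mul_of_bound (ℱ.le s) hH (hM.integrable s') C
    (Eventually.of_forall hC)
  have h2 := hM.condExp_ae_eq hs
  calc ∫ ω, H ω * M s' ω ∂P = ∫ ω, (P[H * M s' | ℱ s]) ω ∂P := (integral_condExp (ℱ.le s)).symm
    _ = ∫ ω, H ω * M s ω ∂P := integral_congr_ae (by
      filter_upwards [h1, h2] with ω h1 h2
      rw [h1, Pi.mul_apply, h2])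

section Dynkin

variable {n : ℕ} {Ω : Type*} [MeasurableSpace Ω] {P : Measure Ω} {Z : Ω → JumpPath n}
  {hZ : Measurable Z} {μ : Fin n → Fin n → ℝ → ℝ} {t₀ : ℝ}

theorem intensityMatrix_offDiag (μ : Fin n → Fin n → ℝ → ℝ) (t : ℝ) {j k : Fin n} (h : j ≠ k) :
    intensityMatrix μ t j k = μ j k t := by simp [intensityMatrix, h]

theorem intensityMatrix_diag (μ : Fin n → Fin n → ℝ → ℝ) (t : ℝ) (j : Fin n) :
    intensityMatrix μ t j j = -∑ l ∈ Finset.univ.erase j, μ j l t := by simp [intensityMatrix]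

/-- The integral of the intensity process does not see the jump times, which are a null set. -/
theorem integral_intensityProcess_eq {a : Fin n → Fin n → ℝ → ℝ}
    (ha : ∀ j k u, t₀ ≤ u → a j k u = intensityMatrix μ u j k) {j k : Fin n} (hjk : j ≠ k)
    (z : JumpPath n) {s : ℝ} (hs : t₀ ≤ s) :
    ∫ u in t₀..s, intensityProcess μ z j k u
      = ∫ u in t₀..s, if z u = j then a j k u else 0 := by
  refine intervalIntegral.integral_congr_ae ?_
  filter_upwards [z.ae_leftLim_eq] with u hu hmem
  rw [uIoc_of_le hs] at hmem
  rw [intensityProcess, hu, ha j k u hmem.1.le, intensityMatrix_offDiag μ u hjk]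

/-- The indicator of the state `j` minus the integral of its conditional rate of change is a sum of
increments of compensated counting processes. -/
theorem ite_sub_ite_sub_integral_eq_sum {a : Fin n → Fin n → ℝ → ℝ}
    (hac : ∀ j k, Continuous (a j k))
    (ha : ∀ j k u, t₀ ≤ u → a j k u = intensityMatrix μ u j k) (j : Fin n) (z : JumpPath n)
    {s s' : ℝ} (hs : t₀ ≤ s) (hs' : s ≤ s') :
    ((if z s' = j then (1 : ℝ) else 0) - if z s = j then 1 else 0)
        - ∫ u in s..s', a (z u) j u
      = ∑ k ∈ Finset.univ.erase j,
        ((((jumpCount z k j t₀ s' : ℝ) - ∫ u in t₀..s', intensityProcess μ z k j u)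
          - ((jumpCount z k j t₀ s : ℝ) - ∫ u in t₀..s, intensityProcess μ z k j u))
        - (((jumpCount z j k t₀ s' : ℝ) - ∫ u in t₀..s', intensityProcess μ z j k u)
          - ((jumpCount z j k t₀ s : ℝ) - ∫ u in t₀..s, intensityProcess μ z j k u))) := by
  have hii : ∀ (l k m : Fin n) (c d : ℝ), IntervalIntegrable
      (fun u => if z u = m then a l k u else 0) volume c d := fun l k m c d => by
    obtain ⟨C, hC⟩ := (isCompact_uIcc (a := c) (b := d)).exists_bound_of_continuousOn
      (hac l k).continuousOn
    refine z.intervalIntegrable_comp (g := fun i u => if i = m then a l k u else 0)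
      (fun i => ?_) (C := |C|) (fun i u hu => ?_)
    · split_ifs
      exacts [(hac l k).measurable, measurable_const]
    · split_ifs
      exacts [(hC u hu).trans (le_abs_self C), by simp]
  have hdiff : ∀ l k : Fin n, l ≠ k → (∫ u in t₀..s', intensityProcess μ z l k u)
      - ∫ u in t₀..s, intensityProcess μ z l k u
        = ∫ u in s..s', if z u = l then a l k u else 0 := fun l k hlk => by
    rw [integral_intensityProcess_eq ha hlk z hs, integral_intensityProcess_eq ha hlk z
      (hs.trans hs'), intervalIntegral.integral_interval_sub_left (hii _ _ _ _ _) (hii _ _ _ _ _)]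
  have hint : ∫ u in s..s', a (z u) j u = ∑ k ∈ Finset.univ.erase j,
      ((∫ u in s..s', if z u = k then a k j u else 0)
        - ∫ u in s..s', if z u = j then a j k u else 0) := by
    simp_rw [← intervalIntegral.integral_sub (hii _ _ _ _ _) (hii _ _ _ _ _)]
    rw [← intervalIntegral.integral_finsetSum fun k _ => (hii _ _ _ _ _).sub (hii _ _ _ _ _)]
    refine intervalIntegral.integral_congr fun u hu => ?_
    rw [uIcc_of_le hs'] at hu
    have hu0 := hs.trans hu.1
    simp only [Finset.sum_sub_distrib]
    by_cases hz : z u = j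
    · rw [hz, ha j j u hu0, intensityMatrix_diag]
      have h1 : ∑ k ∈ Finset.univ.erase j, (if j = k then a k j u else 0) = 0 :=
        Finset.sum_eq_zero fun k hk => if_neg (Finset.ne_of_mem_erase hk).symm
      rw [h1, zero_sub, neg_inj]
      refine Finset.sum_congr rfl fun k hk => ?_
      rw [if_pos rfl, ha j k u hu0, intensityMatrix_offDiag μ u (Finset.ne_of_mem_erase hk).symm]
    · simp [hz]
  rw [z.ite_sub_ite_eq_sum_jumpCount j hs', hint, ← Finset.sum_sub_distrib]
  refine Finset.sum_congr rfl fun k hk => ?_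
  have hk := Finset.ne_of_mem_erase hk
  rw [← hdiff k j hk, ← hdiff j k hk.symm, z.jumpCount_add hk hs hs',
    z.jumpCount_add hk.symm hs hs']
  push_cast
  ring

/-- Dynkin's formula: the indicator of the state `j` has conditional rate of change `a_{Z(u) j}(u)`,
because the compensated counting processes are martingales. -/
theorem IsMarkovJumpProcess.integral_mul_increment [IsProbabilityMeasure P]
    (h : IsMarkovJumpProcess μ t₀ P Z hZ) {a : Fin n → Fin n → ℝ → ℝ}
    (hac : ∀ j k, Continuous (a j k))
    (ha : ∀ j k u, t₀ ≤ u → a j k u = intensityMatrix μ u j k) (j : Fin n)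
    {s s' : ℝ} (hs : t₀ ≤ s) (hs' : s ≤ s') {H : Ω → ℝ}
    (hH : Measurable[historyFrom t₀ Z hZ ⟨s, hs⟩] H) {C : ℝ} (hC : ∀ ω, |H ω| ≤ C) :
    ∫ ω, H ω * (((if Z ω s' = j then (1 : ℝ) else 0) - if Z ω s = j then 1 else 0)
      - ∫ u in s..s', a (Z ω u) j u) ∂P = 0 := by
  have hH' : StronglyMeasurable[historyFrom t₀ Z hZ ⟨s, hs⟩] H := hH.stronglyMeasurable
  have hHm : AEStronglyMeasurable H P :=
    (hH'.mono ((historyFrom t₀ Z hZ).le _)).aestronglyMeasurable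
  have hle : (⟨s, hs⟩ : Ici t₀) ≤ ⟨s', hs.trans hs'⟩ := hs'
  let M : Fin n → Fin n → ℝ → Ω → ℝ := fun k l r ω =>
    (jumpCount (Z ω) k l t₀ r : ℝ) - ∫ u in t₀..r, intensityProcess μ (Z ω) k l u
  have hi : ∀ k l, k ≠ l → ∀ r, t₀ ≤ r → Integrable (fun ω => H ω * M k l r ω) P :=
    fun k l hkl r hr => ((h.intensity k l hkl).integrable ⟨r, hr⟩).bdd_mul hHm
      (Eventually.of_forall hC)
  have hD : ∀ k l, k ≠ l → Integrable (fun ω => H ω * (M k l s' ω - M k l s ω)) P ∧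
      ∫ ω, H ω * (M k l s' ω - M k l s ω) ∂P = 0 := fun k l hkl => by
    have h1 := hi k l hkl s' (hs.trans hs')
    have h2 := hi k l hkl s hs
    simp_rw [mul_sub]
    exact ⟨h1.sub h2, by
      rw [integral_sub h1 h2, sub_eq_zero]
      exact (h.intensity k l hkl).integral_mul_eq hle hH' hC⟩
  have e : ∀ ω, H ω * (((if Z ω s' = j then (1 : ℝ) else 0) - if Z ω s = j then 1 else 0)
      - ∫ u in s..s', a (Z ω u) j u) = ∑ k ∈ Finset.univ.erase j,
        (H ω * (M k j s' ω - M k j s ω) - H ω * (M j k s' ω - M j k s ω)) := fun ω => by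
    rw [ite_sub_ite_sub_integral_eq_sum hac ha j (Z ω) hs hs', Finset.mul_sum]
    exact Finset.sum_congr rfl fun k _ => mul_sub _ _ _
  simp_rw [e]
  rw [integral_finsetSum]
  swap
  · exact fun k hk => (hD k j (Finset.ne_of_mem_erase hk)).1.sub
      (hD j k (Finset.ne_of_mem_erase hk).symm).1
  refine Finset.sum_eq_zero fun k hk => ?_
  have hk := Finset.ne_of_mem_erase hk
  rw [integral_sub (hD k j hk).1 (hD j k hk.symm).1, (hD k j hk).2, (hD j k hk.symm).2, sub_zero]

end Dynkin

/-! ### Right derivatives -/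

/-- If a continuous function has a continuous right derivative, then this is its derivative. -/
theorem hasDerivWithinAt_Ici_of_right {f g : ℝ → ℝ} {t : ℝ} (hf : ContinuousOn f (Ici t))
    (hg : ContinuousOn g (Ici t)) (h : ∀ s, t ≤ s → HasDerivWithinAt f (g s) (Ici s) s) {s : ℝ}
    (hs : t ≤ s) : HasDerivWithinAt f (g s) (Ici t) s := by
  have hmax : Continuous fun u : ℝ => max u t := continuous_id.max continuous_const
  have hG : Continuous fun u => g (max u t) :=
    hg.comp_continuous hmax fun u => le_max_right u t
  have hD : ∀ x, HasDerivAt (fun x => ∫ u in t..x, g (max u t)) (g (max x t)) x := fun x =>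
    intervalIntegral.integral_hasDerivAt_right (hG.intervalIntegrable _ _)
      (hG.stronglyMeasurableAtFilter _ _) hG.continuousAt
  have key : ∀ x, t ≤ x → f x = (∫ u in t..x, g (max u t)) + f t := fun x hx => by
    have := constant_of_has_deriv_right_zero (a := t) (b := x)
      (f := fun x => f x - ∫ u in t..x, g (max u t))
      ((hf.mono Icc_subset_Ici_self).sub
        (continuousOn_of_forall_continuousAt fun x _ => (hD x).continuousAt))
      (fun y hy => by
        have := (h y hy.1).sub (hD y).hasDerivWithinAt
        rw [max_eq_left hy.1, sub_self] at this
        exact this)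
      x (right_mem_Icc.2 hx)
    simp only [intervalIntegral.integral_same, sub_zero] at this
    linarith
  have := ((hD s).add_const (f t)).hasDerivWithinAt (s := Ici t)
  rw [max_eq_left hs] at this
  exact this.congr (fun x hx => key x hx) (key s hs)

/-! ### Linear evolution equations in a normed ring -/

section Evolution

variable {R : Type*} [NormedRing R] [NormedAlgebra ℝ R] {p : ℝ → ℝ → R} {B : ℝ → R}

/-- The evolution system of a linear differential equation has the semigroup property, by
uniqueness of the solution that starts at time `r` from `p t r`. -/
theorem mul_eq_of_forward (hB : Continuous B)
    (hp : ∀ t s, 0 ≤ t → t ≤ s → HasDerivWithinAt (p t) (p t s * B s) (Ici t) s)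
    (h1 : ∀ t, 0 ≤ t → p t t = 1) {t r s : ℝ} (ht : 0 ≤ t) (htr : t ≤ r) (hrs : r ≤ s) :
    p t r * p r s = p t s := by
  obtain ⟨K, hK⟩ := (isCompact_Icc (a := r) (b := s)).exists_bound_of_continuousOn hB.continuousOn
  have hr : 0 ≤ r := ht.trans htr
  have hd : ∀ x, r ≤ x → HasDerivWithinAt (fun x => p t r * p r x - p t x)
      ((p t r * p r x - p t x) * B x) (Ici r) x := fun x hx => by
    have := ((hp r x hr hx).const_mul (p t r)).sub
      ((hp t x ht (htr.trans hx)).mono (Ici_subset_Ici.2 htr))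
    rwa [← mul_assoc, ← sub_mul] at this
  have := eq_zero_of_abs_deriv_le_mul_abs_self_of_eq_zero_right (a := r) (b := s) (K := K)
    (f := fun x => p t r * p r x - p t x)
    (fun x hx => (hd x hx.1).continuousWithinAt.mono Icc_subset_Ici_self)
    (fun x hx => (hd x hx.1).mono (Ici_subset_Ici.2 hx.1))
    (by simp [h1 r hr])
    (fun x hx => by
      refine (norm_mul_le _ _).trans ?_
      rw [mul_comm]
      exact mul_le_mul_of_nonneg_right (hK x ⟨hx.1, hx.2.le⟩) (norm_nonneg _))
    s (right_mem_Icc.2 hrs)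
  exact sub_eq_zero.1 this

theorem exists_norm_le_of_forward (hB : Continuous B)
    (hp : ∀ t s, 0 ≤ t → t ≤ s → HasDerivWithinAt (p t) (p t s * B s) (Ici t) s)
    (h1 : ∀ t, 0 ≤ t → p t t = 1) (T : ℝ) :
    ∃ M, 0 ≤ M ∧ ∀ a b, 0 ≤ a → a ≤ b → b ≤ T → ‖p a b‖ ≤ M := by
  obtain ⟨K, hK⟩ := (isCompact_Icc (a := 0) (b := T)).exists_bound_of_continuousOn hB.continuousOn
  refine ⟨‖(1 : R)‖ * Real.exp (|K| * |T|), by positivity, fun a b ha hab hb => ?_⟩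
  have := norm_le_gronwallBound_of_norm_deriv_right_le (a := a) (b := b) (f := p a) (K := |K|)
    (ε := 0) (δ := ‖(1 : R)‖)
    (fun x hx => (hp a x ha hx.1).continuousWithinAt.mono Icc_subset_Ici_self)
    (fun x hx => (hp a x ha hx.1).mono (Ici_subset_Ici.2 hx.1))
    (by rw [h1 a ha])
    (fun x hx => by
      rw [add_zero, mul_comm]
      refine (norm_mul_le _ _).trans (mul_le_mul_of_nonneg_left ?_ (norm_nonneg _))
      exact (hK x ⟨ha.trans hx.1, hx.2.le.trans hb⟩).trans (le_abs_self K))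
    b (right_mem_Icc.2 hab)
  refine this.trans ?_
  rw [gronwallBound_ε0]
  have : b - a ≤ |T| := by linarith [le_abs_self T]
  gcongr

theorem exists_norm_sub_one_le_of_forward (hB : Continuous B)
    (hp : ∀ t s, 0 ≤ t → t ≤ s → HasDerivWithinAt (p t) (p t s * B s) (Ici t) s)
    (h1 : ∀ t, 0 ≤ t → p t t = 1) (T : ℝ) :
    ∃ C, 0 ≤ C ∧ ∀ a b, 0 ≤ a → a ≤ b → b ≤ T → ‖p a b - 1‖ ≤ C * (b - a) := by
  obtain ⟨K, hK⟩ := (isCompact_Icc (a := 0) (b := T)).exists_bound_of_continuousOn hB.continuousOn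
  obtain ⟨M, hM0, hM⟩ := exists_norm_le_of_forward hB hp h1 T
  refine ⟨M * |K|, by positivity, fun a b ha hab hb => ?_⟩
  have := norm_image_sub_le_of_norm_deriv_right_le_segment (a := a) (b := b) (f := p a)
    (C := M * |K|)
    (fun x hx => (hp a x ha hx.1).continuousWithinAt.mono Icc_subset_Ici_self)
    (fun x hx => (hp a x ha hx.1).mono (Ici_subset_Ici.2 hx.1))
    (fun x hx => (norm_mul_le _ _).trans (mul_le_mul (hM a x ha hx.1 (hx.2.le.trans hb))
      ((hK x ⟨ha.trans hx.1, hx.2.le.trans hb⟩).trans (le_abs_self K)) (norm_nonneg _) hM0))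
    b (right_mem_Icc.2 hab)
  rwa [h1 a ha] at this

/-- First-order expansion of the evolution system on the diagonal, uniformly over the short
intervals `[a, b]` close to `t`. -/
theorem exists_norm_sub_one_sub_smul_le (hB : Continuous B)
    (hp : ∀ t s, 0 ≤ t → t ≤ s → HasDerivWithinAt (p t) (p t s * B s) (Ici t) s)
    (h1 : ∀ t, 0 ≤ t → p t t = 1) (t : ℝ) {ε : ℝ} (hε : 0 < ε) :
    ∃ η > 0, ∀ a b, 0 ≤ a → a ≤ b → |a - t| < η → |b - t| < η →
      ‖p a b - 1 - (b - a) • B t‖ ≤ ε * (b - a) := by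
  obtain ⟨C, hC0, hC⟩ := exists_norm_sub_one_le_of_forward hB hp h1 (t + 1)
  -- the function whose value at `(b - a, b)` dominates the derivative of the remainder
  have hcont : Tendsto (fun h : ℝ × ℝ => C * h.1 * ‖B h.2‖ + ‖B h.2 - B t‖) (𝓝 (0, t)) (𝓝 0) := by
    have : Continuous fun h : ℝ × ℝ => C * h.1 * ‖B h.2‖ + ‖B h.2 - B t‖ := by fun_prop
    simpa using this.tendsto (0, t)
  obtain ⟨η, hη, hball⟩ := Metric.eventually_nhds_iff.1 (hcont.eventually_lt_const hε)
  refine ⟨min (η / 2) 1, by positivity, fun a b ha hab hat hbt => ?_⟩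
  have hη1 := min_le_left (η / 2) 1
  have hη2 := min_le_right (η / 2) 1
  rw [abs_lt] at hat hbt
  have := norm_image_sub_le_of_norm_deriv_right_le_segment (a := a) (b := b)
    (f := fun x => p a x - (x - a) • B t) (f' := fun x => p a x * B x - B t) (C := ε)
    (fun x hx => ((hp a x ha hx.1).continuousWithinAt.mono Icc_subset_Ici_self).sub
      (by fun_prop))
    (fun x hx => ((hp a x ha hx.1).mono (Ici_subset_Ici.2 hx.1)).sub (by
      simpa using (((hasDerivAt_id x).sub_const a).smul_const (B t)).hasDerivWithinAt))
    (fun x hx => by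
      have hx2 := hx.2
      have hx1 := hx.1
      have e : p a x * B x - B t = (p a x - 1) * B x + (B x - B t) := by rw [sub_mul]; simp
      rw [e]
      refine (norm_add_le _ _).trans (le_trans ?_ (hball (y := (x - a, x)) ?_).le)
      · refine add_le_add_left ((norm_mul_le _ _).trans ?_) _
        exact mul_le_mul_of_nonneg_right (hC a x ha hx.1 (by linarith)) (norm_nonneg _)
      · rw [Prod.dist_eq, max_lt_iff, Real.dist_eq, Real.dist_eq, abs_lt, abs_lt]
        constructor <;> constructor <;> simp only [] <;> linarith)
    b (right_mem_Icc.2 hab)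
  simp only [h1 a ha, sub_self, zero_smul, sub_zero] at this
  rwa [sub_right_comm]

/-- The evolution system of a linear differential equation satisfies the backward equation. -/
theorem hasDerivWithinAt_backward (hB : Continuous B)
    (hp : ∀ t s, 0 ≤ t → t ≤ s → HasDerivWithinAt (p t) (p t s * B s) (Ici t) s)
    (h1 : ∀ t, 0 ≤ t → p t t = 1) {t s : ℝ} (ht : 0 ≤ t) (hts : t ≤ s) :
    HasDerivWithinAt (fun t' => p t' s) (-(B t * p t s)) (Icc 0 s) t := by
  obtain ⟨C, hC0, hC⟩ := exists_norm_sub_one_le_of_forward hB hp h1 s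
  obtain ⟨M, hM0, hM⟩ := exists_norm_le_of_forward hB hp h1 s
  rw [hasDerivWithinAt_iff_isLittleO, Asymptotics.isLittleO_iff]
  intro ε hε
  obtain ⟨η, hη, hsmall⟩ := exists_norm_sub_one_sub_smul_le hB hp h1 t
    (ε := ε / (2 * (M + 1))) (by positivity)
  have hεM : ε / (2 * (M + 1)) * M ≤ ε / 2 := by
    rw [div_mul_eq_mul_div, div_le_div_iff₀ (by positivity) (by positivity)]
    nlinarith
  have hlim : Tendsto (fun t' => ‖B t‖ * (C * (t' - t) * M)) (𝓝 t) (𝓝 0) := by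
    have : Continuous fun t' => ‖B t‖ * (C * (t' - t) * M) := by fun_prop
    simpa using this.tendsto t
  filter_upwards [self_mem_nhdsWithin, mem_nhdsWithin_of_mem_nhds (Metric.ball_mem_nhds t hη),
    mem_nhdsWithin_of_mem_nhds (hlim.eventually_lt_const (half_pos hε))] with t' ht' hη' hl
  rw [Metric.mem_ball, Real.dist_eq] at hη'
  have h0 : |t - t| < η := by simpa using hη
  rcases le_total t' t with h | h
  -- to the left of `t`: the factor `p t s` in `p t' s = p t' t * p t s` is fixed
  · have e : p t' s - p t s - (t' - t) • -(B t * p t s)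
        = (p t' t - 1 - (t - t') • B t) * p t s := by
      rw [← mul_eq_of_forward hB hp h1 ht'.1 h hts]
      simp only [sub_mul, smul_mul_assoc, one_mul, smul_neg, sub_smul]
      abel
    rw [e, Real.norm_eq_abs, abs_of_nonpos (sub_nonpos.2 h), neg_sub]
    refine (norm_mul_le _ _).trans ?_
    have h2 := mul_le_mul (hsmall t' t ht'.1 h hη' h0) (hM t s ht hts le_rfl) (norm_nonneg _)
      (mul_nonneg (by positivity) (sub_nonneg.2 h))
    refine h2.trans ?_
    rw [mul_right_comm]
    exact mul_le_mul_of_nonneg_right (hεM.trans (half_le_self hε.le)) (sub_nonneg.2 h)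
  -- to the right of `t`: in `p t s = p t t' * p t' s` the factor `p t' s` moves, which costs a term
  -- of second order
  · have e : p t' s - p t s - (t' - t) • -(B t * p t s)
        = -((p t t' - 1 - (t' - t) • B t) * p t' s)
          + (t' - t) • (B t * ((p t t' - 1) * p t' s)) := by
      rw [← mul_eq_of_forward hB hp h1 ht h ht'.2]
      simp only [sub_mul, mul_sub, smul_mul_assoc, one_mul, smul_neg, smul_sub]
      abel
    have hM' := hM t' s ht'.1 ht'.2 le_rfl
    have hd := sub_nonneg.2 h
    rw [e, Real.norm_eq_abs, abs_of_nonneg hd]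
    have h2 : ‖(p t t' - 1 - (t' - t) • B t) * p t' s‖ ≤ ε / 2 * (t' - t) := by
      refine (norm_mul_le _ _).trans ((mul_le_mul (hsmall t t' ht h h0 hη') hM' (norm_nonneg _)
        (mul_nonneg (by positivity) hd)).trans ?_)
      rw [mul_right_comm]
      exact mul_le_mul_of_nonneg_right hεM hd
    have h3 : ‖(t' - t) • (B t * ((p t t' - 1) * p t' s))‖ ≤ ε / 2 * (t' - t) := by
      rw [norm_smul, Real.norm_eq_abs, abs_of_nonneg hd, mul_comm (ε / 2)]
      refine mul_le_mul_of_nonneg_left (le_trans ?_ hl.le) hd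
      refine (norm_mul_le _ _).trans (mul_le_mul_of_nonneg_left ?_ (norm_nonneg _))
      exact (norm_mul_le _ _).trans
        (mul_le_mul (hC t t' ht h ht'.2) hM' (norm_nonneg _) (mul_nonneg hC0 hd))
    calc _ ≤ ‖-((p t t' - 1 - (t' - t) • B t) * p t' s)‖ + _ := norm_add_le _ _
      _ ≤ ε / 2 * (t' - t) + ε / 2 * (t' - t) := by rw [norm_neg]; exact add_le_add h2 h3
      _ = ε * (t' - t) := by ring

end Evolution

/-! ### The forward equation under one law -/

theorem abs_exp_sub_exp_le {x y M : ℝ} (hx : Real.exp x ≤ M) (hy : Real.exp y ≤ M) :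
    |Real.exp x - Real.exp y| ≤ M * |x - y| := by
  wlog h : y ≤ x generalizing x y
  · rw [abs_sub_comm, abs_sub_comm x]
    exact this hy hx (le_of_not_ge h)
  rw [abs_of_nonneg (sub_nonneg.2 (Real.exp_le_exp.2 h)), abs_of_nonneg (sub_nonneg.2 h)]
  have h1 : Real.exp y = Real.exp x * Real.exp (y - x) := by rw [← Real.exp_add]; ring_nf
  calc Real.exp x - Real.exp y = Real.exp x * (1 - Real.exp (y - x)) := by rw [h1]; ring
    _ ≤ Real.exp x * (x - y) :=
      mul_le_mul_of_nonneg_left (by linarith [Real.add_one_le_exp (y - x)]) (Real.exp_pos x).le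
    _ ≤ M * (x - y) := mul_le_mul_of_nonneg_right hx (sub_nonneg.2 h)

theorem exists_abs_le_of_continuous {ι : Type*} [Fintype ι] {g : ι → ℝ → ℝ}
    (hg : ∀ k, Continuous (g k)) (a b : ℝ) :
    ∃ C, 0 ≤ C ∧ ∀ k, ∀ u ∈ Icc a b, |g k u| ≤ C := by
  obtain ⟨C, hC⟩ := (isCompact_Icc (a := a) (b := b)).exists_bound_of_continuousOn
    (f := fun u => ∑ k, |g k u|) (continuous_finsetSum _ fun k _ => (hg k).abs).continuousOn
  refine ⟨|C|, abs_nonneg C, fun k u hu => ?_⟩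
  calc |g k u| ≤ ∑ k, |g k u| :=
        Finset.single_le_sum (f := fun k => |g k u|) (fun _ _ => abs_nonneg _) (Finset.mem_univ k)
    _ ≤ ‖∑ k, |g k u|‖ := le_abs_self _
    _ ≤ |C| := (hC u hu).trans (le_abs_self C)

namespace JumpPath

variable {n : ℕ} {g : Fin n → ℝ → ℝ}

theorem intervalIntegrable_comp_of_continuous (z : JumpPath n) (hg : ∀ k, Continuous (g k))
    (a b : ℝ) : IntervalIntegrable (fun u => g (z u) u) volume a b := by
  obtain ⟨C, -, hC⟩ := exists_abs_le_of_continuous hg (min a b) (max a b)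
  exact z.intervalIntegrable_comp (fun k => (hg k).measurable) hC

theorem abs_integral_comp_le (z : JumpPath n) {t T C : ℝ} (hC : ∀ k, ∀ u ∈ Icc t T, |g k u| ≤ C)
    {s s' : ℝ} (hs : t ≤ s) (hss' : s ≤ s') (hs' : s' ≤ T) :
    |∫ u in s..s', g (z u) u| ≤ C * (s' - s) := by
  have := intervalIntegral.norm_integral_le_of_norm_le_const (a := s) (b := s') (C := C)
    (f := fun u => g (z u) u) fun u hu => by
      rw [uIoc_of_le hss'] at hu
      exact hC _ u ⟨hs.trans hu.1.le, hu.2.trans hs'⟩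
  rwa [abs_of_nonneg (sub_nonneg.2 hss')] at this

/-- The integral along a path has the integrand as its right derivative, because the path is
right-continuous. -/
theorem hasDerivWithinAt_integral_comp (z : JumpPath n) (hg : ∀ k, Continuous (g k)) (t s : ℝ) :
    HasDerivWithinAt (fun x => ∫ u in t..x, g (z u) u) (g (z s) s) (Ici s) s := by
  refine intervalIntegral.integral_hasDerivWithinAt_right (s := Ici s) (t := Ioi s)
    (z.intervalIntegrable_comp_of_continuous hg t s) ?_ ?_
  · exact (z.measurable_comp fun k => (hg k).measurable).stronglyMeasurable.stronglyMeasurableAtFilter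
  · refine ((hg (z s)).continuousWithinAt (s := Ioi s) (x := s)).congr_of_eventuallyEq ?_ rfl
    filter_upwards [z.right_continuous s] with u hu
    rw [hu]

end JumpPath

/-- The discount factor `exp (-∫_t^s δ_{z(u)}(u) du)` along the path `z`. -/
noncomputable def discount {n : ℕ} (δ : Fin n → ℝ → ℝ) (t s : ℝ) (z : JumpPath n) : ℝ :=
  Real.exp (-∫ u in t..s, δ (z u) u)

/-- Under the law `Q` on paths, the indicator of each state `j` has, on `[t, ∞)`, the conditional
rate of change `a_{z(u) j}(u)`: its increment minus the integral of this rate is orthogonal to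
the bounded functions of the past. -/
def HasDynkinFormula {n : ℕ} (a : Fin n → Fin n → ℝ → ℝ) (t : ℝ) (Q : Measure (JumpPath n)) :
    Prop :=
  ∀ (j : Fin n) (s s' : ℝ) (hs : t ≤ s), s ≤ s' → ∀ G : JumpPath n → ℝ,
    Measurable[historyFrom t (fun z : JumpPath n => z) measurable_id ⟨s, hs⟩] G →
    ∀ C : ℝ, (∀ z, |G z| ≤ C) →
    ∫ z, G z * (((if z s' = j then (1 : ℝ) else 0) - if z s = j then 1 else 0)
      - ∫ u in s..s', a (z u) j u) ∂Q = 0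

section Forward

variable {n : ℕ} {a : Fin n → Fin n → ℝ → ℝ} {δ : Fin n → ℝ → ℝ} {t : ℝ}
  {Q : Measure (JumpPath n)}

theorem discount_le {T C : ℝ} (hC0 : 0 ≤ C) (hC : ∀ k, ∀ u ∈ Icc t T, |δ k u| ≤ C) {s : ℝ}
    (hs : t ≤ s) (hsT : s ≤ T) (z : JumpPath n) :
    discount δ t s z ≤ Real.exp (C * (T - t)) := by
  refine Real.exp_le_exp.2 ((neg_le_abs _).trans ?_)
  exact (z.abs_integral_comp_le hC le_rfl hs hsT).trans
    (mul_le_mul_of_nonneg_left (by linarith) hC0)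

theorem measurable_discount (hδ : ∀ k, Continuous (δ k)) {s : ℝ} (hs : t ≤ s) :
    Measurable (discount δ t s) :=
  (JumpPath.measurable_intervalIntegral_comp (W := fun z : JumpPath n => z) hs
    (fun u _ => JumpPath.measurable_eval u) fun k => (hδ k).measurable).neg.exp

theorem measurable_historyFrom_discount (hδ : ∀ k, Continuous (δ k)) {s : ℝ} (hs : t ≤ s) :
    Measurable[historyFrom t (fun z : JumpPath n => z) measurable_id ⟨s, hs⟩]
      (discount δ t s) := by
  have := @JumpPath.measurable_intervalIntegral_comp n (JumpPath n)
    (historyFrom t (fun z : JumpPath n => z) measurable_id ⟨s, hs⟩) (fun z => z) t s hs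
    (fun u hu => historyFrom_measurable_eval measurable_id ⟨s, hs⟩ hu) δ
    fun k => (hδ k).measurable
  exact Real.measurable_exp.comp this.neg

theorem measurable_ite_state (s : ℝ) (j : Fin n) {f g : JumpPath n → ℝ} (hf : Measurable f)
    (hg : Measurable g) : Measurable fun z : JumpPath n => if z s = j then f z else g z :=
  Measurable.ite (JumpPath.measurable_eval s (measurableSet_singleton j)) hf hg

theorem integrable_of_abs_le [IsFiniteMeasure Q] {f : JumpPath n → ℝ} (hf : Measurable f)
    {C : ℝ} (hC : ∀ z, |f z| ≤ C) : Integrable f Q :=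
  Integrable.of_bound hf.aestronglyMeasurable C (Eventually.of_forall hC)

theorem integrable_ite_discount [IsFiniteMeasure Q] (hδ : ∀ k, Continuous (δ k)) {s : ℝ}
    (hs : t ≤ s) (j : Fin n) :
    Integrable (fun z : JumpPath n => if z s = j then discount δ t s z else 0) Q := by
  obtain ⟨C, hC0, hC⟩ := exists_abs_le_of_continuous hδ t s
  refine integrable_of_abs_le (measurable_ite_state s j (measurable_discount hδ hs)
    measurable_const) (C := Real.exp (C * (s - t))) fun z => ?_
  split_ifs
  · rw [discount, Real.abs_exp]
    exact discount_le hC0 hC hs le_rfl z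
  · simpa using (Real.exp_pos _).le

/-- The integrand that describes the increment over `[s, s']` of the deflated probability of the
state `j`: the rate of change of the indicator, discounted to time `s`, plus the change of the
discount factor on `{z(s') = j}`. -/
noncomputable def deflatedIncrement (a : Fin n → Fin n → ℝ → ℝ) (δ : Fin n → ℝ → ℝ) (t : ℝ)
    (j : Fin n) (s s' : ℝ) (z : JumpPath n) : ℝ :=
  discount δ t s z * (∫ u in s..s', a (z u) j u)
    + if z s' = j then discount δ t s' z - discount δ t s z else 0

theorem measurable_deflatedIncrement (ha : ∀ j k, Continuous (a j k))
    (hδ : ∀ k, Continuous (δ k)) (j : Fin n) {s s' : ℝ} (hs : t ≤ s) (hs' : s ≤ s') :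
    Measurable (deflatedIncrement a δ t j s s') :=
  ((measurable_discount hδ hs).mul
    (JumpPath.measurable_intervalIntegral_comp (W := fun z : JumpPath n => z) hs'
      (fun u _ => JumpPath.measurable_eval u) (g := fun k u => a k j u)
      fun k => (ha k j).measurable)).add
    (measurable_ite_state s' j ((measurable_discount hδ (hs.trans hs')).sub
      (measurable_discount hδ hs)) measurable_const)

theorem exists_abs_deflatedIncrement_le (ha : ∀ j k, Continuous (a j k))
    (hδ : ∀ k, Continuous (δ k)) (t T : ℝ) (j : Fin n) :
    ∃ K, 0 ≤ K ∧ ∀ s s' z, t ≤ s → s ≤ s' → s' ≤ T →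
      |deflatedIncrement a δ t j s s' z| ≤ K * (s' - s) := by
  obtain ⟨C, hC0, hC⟩ := exists_abs_le_of_continuous hδ t T
  obtain ⟨A, hA0, hA⟩ := exists_abs_le_of_continuous (fun k => ha k j) t T
  refine ⟨Real.exp (C * (T - t)) * A + Real.exp (C * (T - t)) * C, by positivity,
    fun s s' z hs hss' hs' => ?_⟩
  have hd := sub_nonneg.2 hss'
  have h1 := discount_le hC0 hC hs (hss'.trans hs') z
  have h2 := discount_le hC0 hC (hs.trans hss') hs' z
  rw [deflatedIncrement, add_mul, mul_assoc, mul_assoc]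
  refine (abs_add_le _ _).trans (add_le_add ?_ ?_)
  · rw [abs_mul]
    refine mul_le_mul ?_ (z.abs_integral_comp_le (g := fun k u => a k j u) hA hs hss' hs')
      (abs_nonneg _) (Real.exp_pos _).le
    rwa [discount, Real.abs_exp]
  · split_ifs
    · refine (abs_exp_sub_exp_le h2 h1).trans (mul_le_mul_of_nonneg_left ?_ (Real.exp_pos _).le)
      rw [neg_sub_neg, abs_sub_comm, intervalIntegral.integral_interval_sub_left
        (z.intervalIntegrable_comp_of_continuous hδ _ _)
        (z.intervalIntegrable_comp_of_continuous hδ _ _)]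
      exact z.abs_integral_comp_le hC hs hss' hs'
    · rw [abs_zero]
      positivity

theorem HasDynkinFormula.integral_sub_eq [IsFiniteMeasure Q] (hQ : HasDynkinFormula a t Q)
    (ha : ∀ j k, Continuous (a j k)) (hδ : ∀ k, Continuous (δ k)) (j : Fin n) {s s' : ℝ}
    (hs : t ≤ s) (hs' : s ≤ s') :
    (∫ z, (if z s' = j then discount δ t s' z else 0) ∂Q)
        - ∫ z, (if z s = j then discount δ t s z else 0) ∂Q
      = ∫ z, deflatedIncrement a δ t j s s' z ∂Q := by
  obtain ⟨C, hC0, hC⟩ := exists_abs_le_of_continuous hδ t s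
  obtain ⟨K, hK0, hK⟩ := exists_abs_deflatedIncrement_le ha hδ t s' j
  have hI : Integrable (deflatedIncrement a δ t j s s') Q :=
    integrable_of_abs_le (measurable_deflatedIncrement ha hδ j hs hs')
      fun z => hK s s' z hs hs' le_rfl
  have h0 := hQ j s s' hs hs' (discount δ t s) (measurable_historyFrom_discount hδ hs)
    (Real.exp (C * (s - t))) fun z => by
      rw [discount, Real.abs_exp]
      exact discount_le hC0 hC hs le_rfl z
  have hX : Integrable (fun z : JumpPath n => (if z s' = j then discount δ t s' z else 0)
      - if z s = j then discount δ t s z else 0) Q :=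
    (integrable_ite_discount (Q := Q) hδ (hs.trans hs') j).sub
      (integrable_ite_discount (Q := Q) hδ hs j)
  rw [← integral_sub (integrable_ite_discount hδ (hs.trans hs') j)
    (integrable_ite_discount hδ hs j), ← sub_eq_zero, ← integral_sub hX hI]
  refine (integral_congr_ae (Eventually.of_forall fun z => ?_)).trans h0
  simp only [deflatedIncrement]
  split_ifs <;> ring

/-- The right derivative of the deflated state probabilities, by dominated convergence. -/
theorem HasDynkinFormula.hasDerivWithinAt_right [IsFiniteMeasure Q] (hQ : HasDynkinFormula a t Q)
    (ha : ∀ j k, Continuous (a j k)) (hδ : ∀ k, Continuous (δ k)) (j : Fin n) {s : ℝ}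
    (hs : t ≤ s) :
    HasDerivWithinAt (fun s => ∫ z, (if z s = j then discount δ t s z else 0) ∂Q)
      (∑ k, (∫ z, (if z s = k then discount δ t s z else 0) ∂Q)
        * (a k j s - if k = j then δ k s else 0)) (Ici s) s := by
  obtain ⟨K, hK0, hK⟩ := exists_abs_deflatedIncrement_le ha hδ t (s + 1) j
  have hlim : ∑ k, (∫ z, (if z s = k then discount δ t s z else 0) ∂Q)
        * (a k j s - if k = j then δ k s else 0)
      = ∫ z, (discount δ t s z * a (z s) j s
        + if z s = j then discount δ t s z * -δ (z s) s else 0) ∂Q := by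
    simp_rw [← integral_mul_const]
    rw [← integral_finsetSum _ fun k _ => (integrable_ite_discount hδ hs k).mul_const _]
    refine integral_congr_ae (Eventually.of_forall fun z => ?_)
    simp only [ite_mul, zero_mul, Finset.sum_ite_eq, Finset.mem_univ, if_true]
    split_ifs <;> ring
  rw [hlim, hasDerivWithinAt_iff_tendsto_slope, Ici_sdiff_left]
  have hev : ∀ᶠ s' in 𝓝[>] s, s' ∈ Ioo s (s + 1) := Ioo_mem_nhdsGT (by linarith)
  have hslope : ∀ᶠ s' in 𝓝[>] s, ∫ z, (s' - s)⁻¹ * deflatedIncrement a δ t j s s' z ∂Q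
      = slope (fun s => ∫ z, (if z s = j then discount δ t s z else 0) ∂Q) s s' := by
    filter_upwards [hev] with s' hs'
    rw [integral_const_mul, ← hQ.integral_sub_eq ha hδ j hs hs'.1.le, slope_def_module, smul_eq_mul]
  refine Tendsto.congr' hslope ?_
  refine tendsto_integral_filter_of_dominated_convergence (fun _ => K) ?_ ?_
    (integrable_const K) (Eventually.of_forall fun z => ?_)
  · filter_upwards [hev] with s' hs'
    exact ((measurable_deflatedIncrement ha hδ j hs hs'.1.le).const_mul _).aestronglyMeasurable
  · filter_upwards [hev] with s' hs'
    refine Eventually.of_forall fun z => ?_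
    have hpos : 0 < s' - s := sub_pos.2 hs'.1
    rw [norm_mul, norm_inv, Real.norm_of_nonneg hpos.le, inv_mul_le_iff₀ hpos, mul_comm]
    exact hK s s' z hs hs'.1.le hs'.2.le
  · have h1 := (hasDerivWithinAt_iff_tendsto_slope.1
      (z.hasDerivWithinAt_integral_comp (g := fun k u => a k j u) (fun k => ha k j) s s))
    have h2 := (hasDerivWithinAt_iff_tendsto_slope.1
      ((z.hasDerivWithinAt_integral_comp hδ t s).neg.exp))
    rw [Ici_sdiff_left] at h1 h2
    have h3 : Tendsto (fun s' => if z s = j then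
        slope (fun x => Real.exp (-∫ u in t..x, δ (z u) u)) s s' else 0) (𝓝[>] s)
        (𝓝 (if z s = j then discount δ t s z * -δ (z s) s else 0)) := by
      split_ifs
      exacts [h2, tendsto_const_nhds]
    refine ((h1.const_mul (discount δ t s z)).add h3).congr' ?_
    filter_upwards [z.right_continuous s] with s' hs'
    rw [deflatedIncrement, hs', slope_def_module, slope_def_module]
    simp only [intervalIntegral.integral_same, sub_zero, smul_eq_mul, discount]
    split_ifs <;> ring

theorem HasDynkinFormula.continuousOn [IsProbabilityMeasure Q] (hQ : HasDynkinFormula a t Q)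
    (ha : ∀ j k, Continuous (a j k)) (hδ : ∀ k, Continuous (δ k)) (j : Fin n) :
    ContinuousOn (fun s => ∫ z, (if z s = j then discount δ t s z else 0) ∂Q) (Ici t) := by
  intro s hs
  obtain ⟨K, hK0, hK⟩ := exists_abs_deflatedIncrement_le ha hδ t (s + 1) j
  have key : ∀ r r', t ≤ r → r ≤ r' → r' ≤ s + 1 →
      |(∫ z, (if z r' = j then discount δ t r' z else 0) ∂Q)
        - ∫ z, (if z r = j then discount δ t r z else 0) ∂Q| ≤ K * (r' - r) :=
    fun r r' hr hrr' hr' => by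
      rw [hQ.integral_sub_eq ha hδ j hr hrr']
      have := norm_integral_le_of_norm_le_const (μ := Q) (f := deflatedIncrement a δ t j r r')
        (Eventually.of_forall fun z => hK r r' z hr hrr' hr')
      simpa using this
  have hsmall : Tendsto (fun r => K * |r - s|) (𝓝[Ici t] s) (𝓝 0) := by
    have : Continuous fun r => K * |r - s| := by fun_prop
    simpa using (this.tendsto s).mono_left nhdsWithin_le_nhds
  refine tendsto_iff_dist_tendsto_zero.2 (squeeze_zero' (Eventually.of_forall fun _ =>
    dist_nonneg) ?_ hsmall)
  filter_upwards [self_mem_nhdsWithin, mem_nhdsWithin_of_mem_nhds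
    (Iic_mem_nhds (lt_add_one s))] with r hr hr1
  rw [Real.dist_eq]
  rcases le_total s r with h | h
  · rw [abs_of_nonneg (sub_nonneg.2 h)]
    exact key s r hs h hr1
  · rw [abs_sub_comm, abs_sub_comm r, abs_of_nonneg (sub_nonneg.2 h)]
    exact key r s hr h (by linarith)

/-- The forward equation for the deflated state probabilities under `Q`. -/
theorem HasDynkinFormula.hasDerivWithinAt [IsProbabilityMeasure Q] (hQ : HasDynkinFormula a t Q)
    (ha : ∀ j k, Continuous (a j k)) (hδ : ∀ k, Continuous (δ k)) (j : Fin n) {s : ℝ}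
    (hs : t ≤ s) :
    HasDerivWithinAt (fun s => ∫ z, (if z s = j then discount δ t s z else 0) ∂Q)
      (∑ k, (∫ z, (if z s = k then discount δ t s z else 0) ∂Q)
        * (a k j s - if k = j then δ k s else 0)) (Ici t) s := by
  refine hasDerivWithinAt_Ici_of_right (hQ.continuousOn ha hδ j) (g := fun s =>
    ∑ k, (∫ z, (if z s = k then discount δ t s z else 0) ∂Q)
        * (a k j s - if k = j then δ k s else 0)) ?_
    (fun s hs => hQ.hasDerivWithinAt_right ha hδ j hs) hs
  refine continuousOn_finsetSum _ fun k _ => (hQ.continuousOn ha hδ k).mul ?_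
  refine ((ha k j).sub ?_).continuousOn
  split_ifs
  exacts [hδ k, continuous_const]

end Forward

/-! ### The conditional laws and the evolution system -/

section Conditional

variable {n : ℕ} {Ω : Type*} [MeasurableSpace Ω] {P : Measure Ω} {Z : Ω → JumpPath n}
  {μ : Fin n → Fin n → ℝ → ℝ} {a : Fin n → Fin n → ℝ → ℝ} {t : ℝ} {t₀ : ℝ}

theorem IsMarkovJumpProcess.hasDynkinFormula {Q : Measure (JumpPath n)} [IsProbabilityMeasure Q]
    (h : IsMarkovJumpProcess μ t Q id measurable_id) (hac : ∀ j k, Continuous (a j k))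
    (ha : ∀ j k u, t ≤ u → a j k u = intensityMatrix μ u j k) : HasDynkinFormula a t Q :=
  fun j _ _ hs hs' _ hG _ hC => h.integral_mul_increment hac ha j hs hs' hG hC

theorem measurable_historyFrom_map (hZ : Measurable Z) (ht : t₀ ≤ t) {s : ℝ} (hs : t ≤ s) :
    Measurable[historyFrom t₀ Z hZ ⟨s, ht.trans hs⟩,
      historyFrom t (fun z : JumpPath n => z) measurable_id ⟨s, hs⟩] Z := by
  refine measurable_iff_le_map.2 (iSup₂_le fun u hu => ?_)
  rintro S ⟨T, hT, rfl⟩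
  exact historyFrom_measurable_eval hZ ⟨s, ht.trans hs⟩ ⟨ht.trans hu.1, hu.2⟩ hT

/-- The law of the path given `Z(t) = i` inherits Dynkin's formula, since the event `{Z(t) = i}`
belongs to the past of every later time. -/
theorem IsMarkovJumpProcess.hasDynkinFormula_cond [IsProbabilityMeasure P] {hZ : Measurable Z}
    (h : IsMarkovJumpProcess μ t₀ P Z hZ) (hac : ∀ j k, Continuous (a j k))
    (ha : ∀ j k u, t₀ ≤ u → a j k u = intensityMatrix μ u j k) (ht : t₀ ≤ t) (i : Fin n) :
    HasDynkinFormula a t ((P[|{ω | Z ω t = i}]).map Z) := by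
  intro j s s' hs hs' G hG C hC
  set A : Set Ω := {ω | Z ω t = i} with hA
  have hGm : Measurable G := hG.mono ((historyFrom t _ measurable_id).le _) le_rfl
  have hAm : MeasurableSet[historyFrom t₀ Z hZ ⟨s, ht.trans hs⟩] A :=
    historyFrom_measurable_eval hZ ⟨s, ht.trans hs⟩ ⟨ht, hs⟩ (measurableSet_singleton i)
  have hF : Measurable fun z : JumpPath n =>
      G z * (((if z s' = j then (1 : ℝ) else 0) - if z s = j then 1 else 0)
        - ∫ u in s..s', a (z u) j u) :=
    hGm.mul (((measurable_ite_state s' j measurable_const measurable_const).sub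
      (measurable_ite_state s j measurable_const measurable_const)).sub
      (JumpPath.measurable_intervalIntegral_comp (W := fun z : JumpPath n => z) hs'
        (fun u _ => JumpPath.measurable_eval u) (g := fun k u => a k j u)
        fun k => (hac k j).measurable))
  have key := h.integral_mul_increment hac ha j (ht.trans hs) hs'
    (H := A.indicator fun ω => G (Z ω))
    (Measurable.indicator (hG.comp (measurable_historyFrom_map hZ ht hs)) hAm) (C := C)
    fun ω => by
      by_cases hω : ω ∈ A
      · simpa [hω] using hC (Z ω)
      · simpa [hω] using (abs_nonneg _).trans (hC (Z ω))
  have hAm' : MeasurableSet A := (historyFrom t₀ Z hZ).le _ _ hAm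
  rw [integral_map hZ.aemeasurable hF.aestronglyMeasurable, ProbabilityTheory.cond,
    integral_smul_measure, ← integral_indicator hAm']
  simp_rw [indicator_mul_left]
  rw [key, smul_zero]

theorem IsRegularConditionalLaw.isProbabilityMeasure [IsProbabilityMeasure P]
    {κ : ℝ → Fin n → Measure (JumpPath n)} (hκ : IsRegularConditionalLaw μ P Z κ)
    (hZ : Measurable Z) (ht : 0 ≤ t) (i : Fin n) : IsProbabilityMeasure (κ t i) := by
  by_cases h0 : P {ω | Z ω t = i} = 0
  · exact (hκ.of_null t ht i h0).1
  · rw [hκ.of_pos t ht i h0]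
    have := cond_isProbabilityMeasure h0
    exact Measure.isProbabilityMeasure_map hZ.aemeasurable

theorem IsRegularConditionalLaw.ae_eval_eq {κ : ℝ → Fin n → Measure (JumpPath n)}
    (hκ : IsRegularConditionalLaw μ P Z κ) (hZ : Measurable Z) (ht : 0 ≤ t) (i : Fin n) :
    ∀ᵐ z ∂(κ t i), z t = i := by
  by_cases h0 : P {ω | Z ω t = i} = 0
  · exact (hκ.of_null t ht i h0).2.1
  · rw [hκ.of_pos t ht i h0, ae_map_iff hZ.aemeasurable
      (p := fun z => z t = i) (JumpPath.measurable_eval t (measurableSet_singleton i))]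
    exact ae_cond_mem (((JumpPath.measurable_eval t).comp hZ) (measurableSet_singleton i))

theorem IsRegularConditionalLaw.hasDynkinFormula [IsProbabilityMeasure P]
    {κ : ℝ → Fin n → Measure (JumpPath n)} (hκ : IsRegularConditionalLaw μ P Z κ)
    {hZ : Measurable Z} (h : IsMarkovJumpProcess μ 0 P Z hZ) (hac : ∀ j k, Continuous (a j k))
    (ha : ∀ j k u, 0 ≤ u → a j k u = intensityMatrix μ u j k) (ht : 0 ≤ t) (i : Fin n) :
    HasDynkinFormula a t (κ t i) := by
  by_cases h0 : P {ω | Z ω t = i} = 0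
  · have := hκ.isProbabilityMeasure hZ ht i
    exact (hκ.of_null t ht i h0).2.2.hasDynkinFormula hac fun j k u hu => ha j k u (ht.trans hu)
  · rw [hκ.of_pos t ht i h0]
    exact h.hasDynkinFormula_cond hac ha ht i

theorem deflatedTransition_apply (κ : ℝ → Fin n → Measure (JumpPath n)) (δ : Fin n → ℝ → ℝ)
    (t s : ℝ) (i j : Fin n) : deflatedTransition κ δ t s i j
      = ∫ z, (if z s = j then discount δ t s z else 0) ∂(κ t i) := by
  simp only [deflatedTransition, Matrix.of_apply, discount]
  refine integral_congr_ae (Eventually.of_forall fun z => ?_)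
  by_cases hz : z s = j <;> simp [hz]

theorem deflatedTransition_congr (κ : ℝ → Fin n → Measure (JumpPath n)) {δ δ' : Fin n → ℝ → ℝ}
    {s : ℝ} (hts : t ≤ s) (h : ∀ k, ∀ u ∈ Icc t s, δ k u = δ' k u) :
    deflatedTransition κ δ t s = deflatedTransition κ δ' t s := by
  ext i j
  simp only [deflatedTransition_apply, discount]
  refine integral_congr_ae (Eventually.of_forall fun z => ?_)
  have : ∫ u in t..s, δ (z u) u = ∫ u in t..s, δ' (z u) u :=
    intervalIntegral.integral_congr fun u hu => h _ u (by rwa [uIcc_of_le hts] at hu)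
  simp only [this]

theorem deflatedTransition_self [IsProbabilityMeasure P]
    {κ : ℝ → Fin n → Measure (JumpPath n)} (hκ : IsRegularConditionalLaw μ P Z κ)
    (hZ : Measurable Z) (δ : Fin n → ℝ → ℝ) (ht : 0 ≤ t) : deflatedTransition κ δ t t = 1 := by
  ext i j
  have := hκ.isProbabilityMeasure hZ ht i
  have h : ∀ᵐ z ∂(κ t i), (if z t = j then discount δ t t z else 0)
      = (1 : Matrix (Fin n) (Fin n) ℝ) i j := by
    filter_upwards [hκ.ae_eval_eq hZ ht i] with z hz
    simp [discount, hz, Matrix.one_apply]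
  rw [deflatedTransition_apply, integral_congr_ae h]
  simp

end Conditional

theorem mainTheorem7 {n : ℕ} {Ω : Type*} [MeasurableSpace Ω]
    (P : Measure Ω) [IsProbabilityMeasure P]
    (Z : Ω → JumpPath n) (hZ : Measurable Z)
    (μ : Fin n → Fin n → ℝ → ℝ)
    (hμ : ∀ j k, j ≠ k → ContinuousOn (μ j k) (Set.Ici 0))
    (hZμ : IsMarkovJumpProcess μ 0 P Z hZ)
    (κ : ℝ → Fin n → Measure (JumpPath n)) (hκ : IsRegularConditionalLaw μ P Z κ)
    (δ : Fin n → ℝ → ℝ) (hδ : ∀ i, ContinuousOn (δ i) (Set.Ici 0)) :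
    (∀ t s, 0 ≤ t → t ≤ s → ∀ i j,
      HasDerivWithinAt (fun s' => deflatedTransition κ δ t s' i j)
        ((deflatedTransition κ δ t s *
          (intensityMatrix μ s - Matrix.diagonal fun k => δ k s)) i j)
        (Set.Ici t) s) ∧
    (∀ t s, 0 ≤ t → t ≤ s → ∀ i j,
      HasDerivWithinAt (fun t' => deflatedTransition κ δ t' s i j)
        ((-((intensityMatrix μ t - Matrix.diagonal fun k => δ k t) *
          deflatedTransition κ δ t s)) i j)
        (Set.Icc 0 s) t) ∧
    (∀ t, 0 ≤ t → deflatedTransition κ δ t t = 1) := by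
  -- the coefficients are only controlled on `[0, ∞)`: extend them to the left by their value at `0`
  have hmax : Continuous fun u : ℝ => max u 0 := continuous_id.max continuous_const
  set a : Fin n → Fin n → ℝ → ℝ := fun j k u => intensityMatrix μ (max u 0) j k with ha_def
  set d : Fin n → ℝ → ℝ := fun k u => δ k (max u 0) with hd_def
  have hμc : ∀ j k, j ≠ k → Continuous fun u => μ j k (max u 0) := fun j k hjk =>
    (hμ j k hjk).comp_continuous hmax fun u => le_max_right u 0
  have hac : ∀ j k, Continuous (a j k) := fun j k => by
    by_cases hjk : j = k
    · subst hjk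
      simp only [ha_def, intensityMatrix_diag]
      exact (continuous_finsetSum _ fun l hl => hμc j l (Finset.ne_of_mem_erase hl).symm).neg
    · simp only [ha_def, intensityMatrix_offDiag μ _ hjk]
      exact hμc j k hjk
  have hdc : ∀ k, Continuous (d k) := fun k =>
    (hδ k).comp_continuous hmax fun u => le_max_right u 0
  have ha : ∀ j k u, 0 ≤ u → a j k u = intensityMatrix μ u j k := fun j k u hu => by
    simp only [ha_def, max_eq_left hu]
  have hd : ∀ k u, 0 ≤ u → δ k u = d k u := fun k u hu => by
    simp only [hd_def, max_eq_left hu]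
  have hpd : ∀ t s, 0 ≤ t → t ≤ s → deflatedTransition κ δ t s = deflatedTransition κ d t s :=
    fun t s ht hts => deflatedTransition_congr κ hts fun k u hu => hd k u (ht.trans hu.1)
  let B : ℝ → Matrix (Fin n) (Fin n) ℝ := fun u =>
    Matrix.of (fun j k => a j k u) - Matrix.diagonal fun k => d k u
  have hB : ∀ u, 0 ≤ u → B u = intensityMatrix μ u - Matrix.diagonal fun k => δ k u :=
    fun u hu => by
      ext j k
      simp [B, ha j k u hu, Matrix.diagonal_apply, hd _ u hu]
  have hBc : Continuous B :=
    (continuous_matrix fun j k => hac j k).sub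
      (Continuous.matrix_diagonal (continuous_pi fun k => hdc k))
  have hforward : ∀ t s, 0 ≤ t → t ≤ s → ∀ i j,
      HasDerivWithinAt (fun s' => deflatedTransition κ δ t s' i j)
        ((deflatedTransition κ δ t s * B s) i j) (Ici t) s := fun t s ht hts i j => by
    have := hκ.isProbabilityMeasure hZ ht i
    have h := (hκ.hasDynkinFormula hZμ hac ha ht i).hasDerivWithinAt hac hdc j hts
    rw [hpd t s ht hts]
    have e : (deflatedTransition κ d t s * B s) i j
        = ∑ k, (∫ z, (if z s = k then discount d t s z else 0) ∂(κ t i))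
          * (a k j s - if k = j then d k s else 0) := by
      simp [Matrix.mul_apply, B, Matrix.diagonal_apply, deflatedTransition_apply]
    rw [e]
    exact h.congr (fun s' hs' => by rw [hpd t s' ht hs', deflatedTransition_apply])
      (by rw [hpd t s ht hts, deflatedTransition_apply])
  have hself : ∀ t, 0 ≤ t → deflatedTransition κ δ t t = 1 := fun t ht =>
    deflatedTransition_self hκ hZ δ ht
  refine ⟨fun t s ht hts i j => ?_, fun t s ht hts i j => ?_, hself⟩
  · rw [← hB s (ht.trans hts)]
    exact hforward t s ht hts i j
  · let _ : NormedRing (Matrix (Fin n) (Fin n) ℝ) := Matrix.linftyOpNormedRing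
    let _ : NormedAlgebra ℝ (Matrix (Fin n) (Fin n) ℝ) := Matrix.linftyOpNormedAlgebra
    have h := hasDerivWithinAt_backward (p := deflatedTransition κ δ) (B := B) hBc
      (fun t s ht hts => hasDerivWithinAt_pi.2 fun i => hasDerivWithinAt_pi.2 fun j =>
        hforward t s ht hts i j) hself ht hts
    rw [← hB t ht]
    exact hasDerivWithinAt_pi.1 (hasDerivWithinAt_pi.1 h i) j
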